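/- Let $\mathcal A$ be a Boolean algebra, let $K_{\mathcal A}$ be its Stone space (the space of ultrafilters of $\mathcal A$ with the topology generated by the sets $[A]=\{x\in K_{\mathcal A}: A\in x\}$, $A\in\mathcal A$), and let $C(K_{\mathcal A})$ be the Banach space of all real-valued continuous functions on $K_{\mathcal A}$ with the supremum norm. A Banach space $X$ has the Grothendieck property if every sequence in the dual $X^*$ converges to a given limit in the weak$^*$ topology if and only if it converges to that limit in the weak topology of $X^*$. Then $C(K_{\mathcal A})$ has the Grothendieck property if and only if the following holds: whenever - $(A_n)_{n\in\mathbb N}$ is a sequence in $\mathcal A$ with $A_m\wedge A_n=0$ for all $m\neq n$, - $\varepsilon>0$, and - $(\mu_n)_{n\in\mathbb N}$ is a sequence of bounded, finitely additive, signed (real-valued) measures on $\mathcal A$ which is bounded in the variation norm $\|\mu\|=\sup\{\sum_{B\in\mathcal F}|\mu(B)| : \mathcal F\subseteq\mathcal A \text{ finite, pairwise disjoint}\}$ and satisfies $|\mu_n(A_n)|>\varepsilon$ for every $n\in\mathbb N$, there is $A\in\mathcal A$ such that the sequence $(\mu_n(A))_{n\in\mathbb N}$ of reals does not converge in $\mathbb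 R$. -/

import Mathlib

open Filter Topology
open scoped ENNReal NNReal

/-- A point of the Stone space `K_A` of a Boolean algebra `A`: an ultrafilter of `A`. -/
@[ext]
structure StoneSpace (A : Type*) [BooleanAlgebra A] where
  /-- The set of elements of the Boolean algebra belonging to the ultrafilter. -/
  carrier : Set A
  top_mem : ⊤ ∈ carrier
  bot_notMem : ⊥ ∉ carrier
  inf_mem : ∀ {a b : A}, a ∈ carrier → b ∈ carrier → a ⊓ b ∈ carrier
  mem_of_le : ∀ {a b : A}, a ≤ b → a ∈ carrier → b ∈ carrier
  mem_or_compl_mem : ∀ a : A, a ∈ carrier ∨ aᶜ ∈ carrier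

namespace StoneSpace

/-- The subset `[a] = {x ∈ K_A : a ∈ x}` of the Stone space. -/
def basicClopen {A : Type*} [BooleanAlgebra A] (a : A) : Set (StoneSpace A) :=
  {x | a ∈ x.carrier}

/-- The Stone topology, generated by the sets `[a]`. -/
instance {A : Type*} [BooleanAlgebra A] : TopologicalSpace (StoneSpace A) :=
  TopologicalSpace.generateFrom (Set.range basicClopen)

/-- The Stone space is compact, so that `C(StoneSpace A, ℝ)` carries the supremum norm. -/
instance {A : Type*} [BooleanAlgebra A] : CompactSpace (StoneSpace A) where
  isCompact_univ := by
    rw [isCompact_iff_ultrafilter_le_nhds]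
    intro F _
    let x : StoneSpace A :=
      { carrier := {a | basicClopen a ∈ F}
        top_mem := by
          have h : basicClopen (⊤ : A) = Set.univ :=
            Set.eq_univ_of_forall fun y => y.top_mem
          change basicClopen (⊤ : A) ∈ F
          rw [h]
          exact Filter.univ_mem
        bot_notMem := by
          have h : basicClopen (⊥ : A) = ∅ :=
            Set.eq_empty_of_forall_notMem fun y => y.bot_notMem
          change ¬ basicClopen (⊥ : A) ∈ F
          rw [h]
          exact F.empty_notMem
        inf_mem := fun {a b} ha hb =>
          Filter.mem_of_superset (Filter.inter_mem ha hb) fun y hy => y.inf_mem hy.1 hy.2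
        mem_of_le := fun {a b} hab ha =>
          Filter.mem_of_superset ha fun y hy => y.mem_of_le hab hy
        mem_or_compl_mem := fun a => by
          rcases F.mem_or_compl_mem (basicClopen a) with h | h
          · exact Or.inl h
          · exact Or.inr (Filter.mem_of_superset h fun y hy =>
              (y.mem_or_compl_mem a).resolve_left hy) }
    refine ⟨x, Set.mem_univ x, ?_⟩
    rw [TopologicalSpace.nhds_generateFrom]
    refine le_iInf₂ fun s hs => ?_
    obtain ⟨hx, a, rfl⟩ := hs
    exact Filter.le_principal_iff.2 hx

end StoneSpace

/-- A real Banach space `X` has the Grothendieck property if weak* convergence and weak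
convergence of sequences in its dual `X*` are equivalent (with the same limit). -/
def HasGrothendieckProperty (X : Type*) [NormedAddCommGroup X] [NormedSpace ℝ X]
    [CompleteSpace X] : Prop :=
  ∀ (f : ℕ → StrongDual ℝ X) (g : StrongDual ℝ X),
    Tendsto (fun n => StrongDual.toWeakDual (f n)) atTop (𝓝 (StrongDual.toWeakDual g)) ↔
      Tendsto (fun n => toWeakSpace ℝ (StrongDual ℝ X) (f n)) atTop
        (𝓝 (toWeakSpace ℝ (StrongDual ℝ X) g))

/-- A bounded, finitely additive, signed (real-valued) measure on a Boolean algebra. -/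
structure FinAddSignedMeasure (A : Type*) [BooleanAlgebra A] where
  /-- The underlying set function. -/
  toFun : A → ℝ
  map_sup_of_disjoint : ∀ a b : A, Disjoint a b → toFun (a ⊔ b) = toFun a + toFun b
  bounded : ∃ C : ℝ, ∀ a : A, |toFun a| ≤ C

namespace FinAddSignedMeasure

instance {A : Type*} [BooleanAlgebra A] : CoeFun (FinAddSignedMeasure A) (fun _ => A → ℝ) :=
  ⟨FinAddSignedMeasure.toFun⟩

/-- The variation norm of `μ`: the supremum of `∑ |μ a|` over finite families of pairwise
disjoint elements. -/
noncomputable def variation {A : Type*} [BooleanAlgebra A] (μ : FinAddSignedMeasure A) : ℝ≥0∞ :=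
  ⨆ (s : Finset A) (_ : (s : Set A).PairwiseDisjoint id), ∑ a ∈ s, ENNReal.ofReal |μ a|

end FinAddSignedMeasure

/-!
Functionals on `C(K)`, for `K` the Stone space of `𝒜`, are identified with bounded finitely additive
measures on `𝒜`: a functional `h` gives `a ↦ h χ_[a]` (`FinAddSignedMeasure.ofDual`), and a measure
gives a functional by taking limits of Riemann sums (`FinAddSignedMeasure.integral`), since step
functions over finite partitions are dense in `C(K)`. In particular weak* convergence of a bounded
sequence is convergence on every `[a]`.

If `C(K)` has the Grothendieck property and the `μ n` converge on every element of `𝒜`, then their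
integrals converge weakly in the dual. For disjoint `A k` and `S ⊆ ℕ`, the map
`φ ↦ ∑ k ∈ S, φ χ_[A k]` is a bounded functional on the dual, so a sliding hump argument, in effect
Schur's theorem for `ℓ¹`, gives `μ n (A n) → 0` (`tendsto_diagonal_of_weak`).

Conversely, let `h n → 0` weak*. The condition on disjoint sequences says that the variations
`|h n|` are uniformly exhaustive (`uniformlyExhaustive_of_forall_not_tendsto`). A disjointification
argument turns this into uniform absolute continuity of all `|h n|`, up to a given error, with
respect to a finite sum `l` of some of them (`UniformlyExhaustive.exists_control`). If `h n` were
not weakly null, then after passing to a subsequence there would be `δ > 0` such that the convex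
sets `C m = {y | ‖y‖ ≤ 1, h i y ≥ δ for i ≤ m}` are all nonempty, by a finite form of Goldstine's
theorem. Near-minimizers `y m ∈ C m` of `y ↦ ∫ y² dl` are Cauchy in `L²(l)` by the parallelogram
identity, hence by Chebyshev's inequality and absolute continuity `h k (y m - y k)` is small for all
`k ≥ m`. So `h k (y m) ≥ δ / 2` for all `k ≥ m`, contradicting `h k (y m) → 0`. Only finite
additivity on `𝒜` is used; no countably additive measures occur.
-/

/-! ### Finitely additive signed measures -/

namespace FinAddSignedMeasure

variable {𝒜 : Type*} [BooleanAlgebra 𝒜] (μ : FinAddSignedMeasure 𝒜)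

lemma map_bot : μ ⊥ = 0 := by
  have := μ.map_sup_of_disjoint ⊥ ⊥ disjoint_bot_left
  simp only [sup_idem] at this
  linarith

lemma map_finset_sup {ι : Type*} (s : Finset ι) (f : ι → 𝒜)
    (h : (s : Set ι).PairwiseDisjoint f) : μ (s.sup f) = ∑ i ∈ s, μ (f i) := by
  classical
  induction s using Finset.induction_on with
  | empty => simpa using μ.map_bot
  | insert i s hi ih =>
    rw [Finset.sup_insert, Finset.sum_insert hi, μ.map_sup_of_disjoint, ih]
    · exact h.subset (by simp)
    · rw [Finset.disjoint_sup_right]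
      intro j hj
      exact h (by simp) (by simp [hj]) (by rintro rfl; exact hi hj)

lemma sum_parts_inf (P : Finpartition (⊤ : 𝒜)) (a : 𝒜) :
    ∑ p ∈ P.parts, μ (p ⊓ a) = μ a := by
  rw [← μ.map_finset_sup P.parts (fun p => p ⊓ a), ← Finset.sup_inf_distrib_right]
  · have : P.parts.sup (fun p => p) = ⊤ := P.sup_parts
    rw [this, top_inf_eq]
  · intro p hp q hq hpq
    exact (P.disjoint hp hq hpq).mono inf_le_left inf_le_left

lemma map_add_map_sdiff {a b : 𝒜} (h : a ≤ b) : μ b = μ a + μ (b \ a) := by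
  rw [← μ.map_sup_of_disjoint _ _ disjoint_sdiff_self_right, sup_sdiff_cancel_right h]

lemma abs_le_of_variation_le {C : ℝ≥0} (h : μ.variation ≤ C) (a : 𝒜) : |μ a| ≤ C := by
  have h1 : ∑ b ∈ ({a} : Finset 𝒜), ENNReal.ofReal |μ b| ≤ μ.variation :=
    le_iSup₂_of_le (f := fun (s : Finset 𝒜) (_ : (s : Set 𝒜).PairwiseDisjoint id) =>
      ∑ b ∈ s, ENNReal.ofReal |μ b|) {a} (by simp) le_rfl
  rw [Finset.sum_singleton] at h1
  have h2 := h1.trans h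
  rw [ENNReal.ofReal_le_coe] at h2
  exact h2

section Nonneg

variable {μ}

lemma mono (hμ : ∀ a, 0 ≤ μ a) {a b : 𝒜} (h : a ≤ b) : μ a ≤ μ b := by
  rw [μ.map_add_map_sdiff h]
  linarith [hμ (b \ a)]

lemma map_sup_le (hμ : ∀ a, 0 ≤ μ a) (a b : 𝒜) : μ (a ⊔ b) ≤ μ a + μ b := by
  rw [← sup_sdiff_self_right, μ.map_sup_of_disjoint _ _ disjoint_sdiff_self_right]
  linarith [mono hμ (sdiff_le : b \ a ≤ b)]

lemma map_finset_sup_le (hμ : ∀ a, 0 ≤ μ a) {ι : Type*} (s : Finset ι) (f : ι → 𝒜) :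
    μ (s.sup f) ≤ ∑ i ∈ s, μ (f i) := by
  classical
  induction s using Finset.induction_on with
  | empty => simpa using μ.map_bot.le
  | insert i s hi ih =>
    rw [Finset.sup_insert, Finset.sum_insert hi]
    exact (map_sup_le hμ _ _).trans (by linarith)

end Nonneg

/-- The value at `a` of the upper (positive) variation of `μ`, the supremum of `μ` over the
elements below `a`. These are parametrized as `b ⊓ a` with `b` arbitrary. -/
noncomputable def upperVar (a : 𝒜) : ℝ := ⨆ b : 𝒜, μ (b ⊓ a)

lemma bddAbove_range_inf (a : 𝒜) : BddAbove (Set.range fun b : 𝒜 => μ (b ⊓ a)) := by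
  obtain ⟨C, hC⟩ := μ.bounded
  exact ⟨C, by rintro _ ⟨b, rfl⟩; exact (le_abs_self _).trans (hC _)⟩

lemma le_upperVar {a b : 𝒜} (h : b ≤ a) : μ b ≤ μ.upperVar a := by
  have := le_ciSup (μ.bddAbove_range_inf a) b
  simpa [upperVar, inf_eq_left.2 h] using this

lemma upperVar_nonneg (a : 𝒜) : 0 ≤ μ.upperVar a := by
  simpa [μ.map_bot] using μ.le_upperVar (bot_le : ⊥ ≤ a)

lemma exists_lt_of_lt_upperVar {a : 𝒜} {r : ℝ} (h : r < μ.upperVar a) : ∃ b ≤ a, r < μ b := by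
  obtain ⟨b, hb⟩ := exists_lt_of_lt_ciSup h
  exact ⟨b ⊓ a, inf_le_right, hb⟩

lemma upperVar_sup {a b : 𝒜} (h : Disjoint a b) :
    μ.upperVar (a ⊔ b) = μ.upperVar a + μ.upperVar b := by
  apply le_antisymm
  · refine ciSup_le fun c => ?_
    rw [inf_sup_left, μ.map_sup_of_disjoint _ _ (h.mono inf_le_right inf_le_right)]
    exact add_le_add (μ.le_upperVar inf_le_right) (μ.le_upperVar inf_le_right)
  · refine le_of_forall_pos_lt_add fun ε hε => ?_
    obtain ⟨c, hc, hc'⟩ := μ.exists_lt_of_lt_upperVar (sub_lt_self (μ.upperVar a) (half_pos hε))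
    obtain ⟨d, hd, hd'⟩ := μ.exists_lt_of_lt_upperVar (sub_lt_self (μ.upperVar b) (half_pos hε))
    have := μ.le_upperVar (sup_le_sup hc hd)
    rw [μ.map_sup_of_disjoint _ _ (h.mono hc hd)] at this
    linarith

/-- The total variation measure `|μ|`, as a finitely additive measure. With `μ = μ⁺ - μ⁻` one has
`|μ| = μ⁺ + μ⁻ = 2μ⁺ - μ`, which is the form used here. -/
noncomputable def totalVar : FinAddSignedMeasure 𝒜 where
  toFun a := 2 * μ.upperVar a - μ a
  map_sup_of_disjoint a b h := by
    rw [μ.upperVar_sup h, μ.map_sup_of_disjoint a b h]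
    ring
  bounded := by
    obtain ⟨C, hC⟩ := μ.bounded
    refine ⟨3 * C, fun a => ?_⟩
    have h1 : μ.upperVar a ≤ C := ciSup_le fun b => (le_abs_self _).trans (hC _)
    have h2 := μ.upperVar_nonneg a
    have h3 := abs_le.1 (hC a)
    rw [abs_le]
    constructor <;> linarith

lemma totalVar_apply (a : 𝒜) : μ.totalVar a = 2 * μ.upperVar a - μ a := rfl

lemma abs_le_totalVar (a : 𝒜) : |μ a| ≤ μ.totalVar a := by
  rw [totalVar_apply]
  have h1 := μ.le_upperVar (le_refl a)
  have h2 := μ.upperVar_nonneg a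
  rw [abs_le]
  constructor <;> linarith

lemma totalVar_nonneg (a : 𝒜) : 0 ≤ μ.totalVar a := (abs_nonneg _).trans (μ.abs_le_totalVar a)

lemma totalVar_le {C : ℝ} (h : ∀ a, |μ a| ≤ C) (a : 𝒜) : μ.totalVar a ≤ 3 * C := by
  have h1 : μ.upperVar a ≤ C := ciSup_le fun b => (le_abs_self _).trans (h _)
  rw [totalVar_apply]
  linarith [abs_le.1 (h a)]

lemma exists_lt_of_lt_totalVar {a : 𝒜} {ε : ℝ} (h : 4 * ε < μ.totalVar a) :
    ∃ b ≤ a, ε < |μ b| := by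
  rw [totalVar_apply] at h
  by_cases h' : ε < μ.upperVar a
  · obtain ⟨b, hb, hb'⟩ := μ.exists_lt_of_lt_upperVar h'
    exact ⟨b, hb, hb'.trans_le (le_abs_self _)⟩
  · exact ⟨a, le_rfl, by linarith [neg_le_abs (μ a), μ.upperVar_nonneg a]⟩

lemma sum_abs_le_totalVar {ι : Type*} (s : Finset ι) (f : ι → 𝒜)
    (h : (s : Set ι).PairwiseDisjoint f) : ∑ i ∈ s, |μ (f i)| ≤ μ.totalVar ⊤ :=
  calc ∑ i ∈ s, |μ (f i)| ≤ ∑ i ∈ s, μ.totalVar (f i) :=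
        Finset.sum_le_sum fun _ _ => μ.abs_le_totalVar _
    _ = μ.totalVar (s.sup f) := (μ.totalVar.map_finset_sup s f h).symm
    _ ≤ μ.totalVar ⊤ := mono μ.totalVar_nonneg le_top

/-- A finite sum of finitely additive measures. -/
noncomputable def finsetSum {ι : Type*} (s : Finset ι) (v : ι → FinAddSignedMeasure 𝒜) :
    FinAddSignedMeasure 𝒜 where
  toFun a := ∑ i ∈ s, v i a
  map_sup_of_disjoint a b h := by
    rw [← Finset.sum_add_distrib]
    exact Finset.sum_congr rfl fun i _ => (v i).map_sup_of_disjoint a b h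
  bounded := by
    choose C hC using fun i => (v i).bounded
    exact ⟨∑ i ∈ s, C i, fun a => (Finset.abs_sum_le_sum_abs _ _).trans
      (Finset.sum_le_sum fun i _ => hC i a)⟩

lemma finsetSum_apply {ι : Type*} (s : Finset ι) (v : ι → FinAddSignedMeasure 𝒜) (a : 𝒜) :
    finsetSum s v a = ∑ i ∈ s, v i a := rfl

end FinAddSignedMeasure

/-! ### Points and clopen sets of the Stone space -/

namespace StoneSpace

variable {𝒜 : Type*} [BooleanAlgebra 𝒜]

lemma compl_mem_iff {x : StoneSpace 𝒜} {a : 𝒜} : aᶜ ∈ x.carrier ↔ a ∉ x.carrier := by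
  refine ⟨fun h h' => x.bot_notMem ?_, fun h => (x.mem_or_compl_mem a).resolve_left h⟩
  simpa using x.inf_mem h' h

lemma mem_sup_iff {x : StoneSpace 𝒜} {a b : 𝒜} :
    a ⊔ b ∈ x.carrier ↔ a ∈ x.carrier ∨ b ∈ x.carrier := by
  refine ⟨fun h => ?_, fun h => h.elim (x.mem_of_le le_sup_left) (x.mem_of_le le_sup_right)⟩
  by_contra! h'
  have := x.inf_mem (compl_mem_iff.2 h'.1) (compl_mem_iff.2 h'.2)
  rw [← compl_sup] at this
  exact compl_mem_iff.1 this h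

lemma mem_finset_sup_iff {x : StoneSpace 𝒜} {ι : Type*} {s : Finset ι} {f : ι → 𝒜} :
    s.sup f ∈ x.carrier ↔ ∃ i ∈ s, f i ∈ x.carrier := by
  classical
  induction s using Finset.induction_on with
  | empty => simpa using x.bot_notMem
  | insert i s _ ih => simp [mem_sup_iff, ih]

lemma notMem_of_disjoint {x : StoneSpace 𝒜} {a b : 𝒜} (h : Disjoint a b)
    (ha : a ∈ x.carrier) : b ∉ x.carrier := fun hb =>
  x.bot_notMem (h.eq_bot ▸ x.inf_mem ha hb)

lemma exists_mem {a : 𝒜} (ha : a ≠ ⊥) : ∃ x : StoneSpace 𝒜, a ∈ x.carrier := by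
  obtain ⟨J, hJ, -, hJa⟩ := DistribLattice.prime_ideal_of_disjoint_filter_ideal
    (F := Order.PFilter.principal a) (I := Order.Ideal.principal (⊥ : 𝒜)) (by
      rw [Set.disjoint_left]
      rintro b hb hb'
      rw [SetLike.mem_coe, Order.PFilter.mem_principal] at hb
      rw [SetLike.mem_coe, Order.Ideal.mem_principal] at hb'
      exact ha (le_bot_iff.1 (hb.trans hb')))
  have hmem (b : 𝒜) : b ∈ J ∨ bᶜ ∈ J := hJ.mem_or_compl_mem
  have hnot (b : 𝒜) : ¬ (b ∈ J ∧ bᶜ ∈ J) := fun h => by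
    have := Order.Ideal.sup_mem h.1 h.2
    rw [sup_compl_eq_top] at this
    exact hJ.toIsProper.top_notMem this
  refine ⟨⟨{b | b ∉ J}, hJ.toIsProper.top_notMem, fun h => h J.bot_mem, ?_, ?_, ?_⟩, ?_⟩
  · exact fun {b c} hb hc h => (hJ.mem_or_mem h).elim hb hc
  · exact fun {b c} hbc hb hc => hb (J.lower hbc hc)
  · intro b
    by_contra! h
    exact hnot b (by simpa using h)
  · exact Set.disjoint_left.1 hJa (by simp)

lemma basicClopen_compl (a : 𝒜) : basicClopen aᶜ = (basicClopen a)ᶜ := by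
  ext x
  exact compl_mem_iff

lemma isOpen_basicClopen (a : 𝒜) : IsOpen (basicClopen a) :=
  TopologicalSpace.isOpen_generateFrom_of_mem ⟨a, rfl⟩

lemma isClopen_basicClopen (a : 𝒜) : IsClopen (basicClopen a) :=
  ⟨⟨basicClopen_compl a ▸ isOpen_basicClopen aᶜ⟩, isOpen_basicClopen a⟩

lemma exists_basicClopen_subset {U : Set (StoneSpace 𝒜)} (hU : IsOpen U) {x : StoneSpace 𝒜}
    (hx : x ∈ U) : ∃ a ∈ x.carrier, basicClopen a ⊆ U := by
  induction hU with
  | basic s hs =>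
    obtain ⟨a, rfl⟩ := hs
    exact ⟨a, hx, le_rfl⟩
  | univ => exact ⟨⊤, x.top_mem, Set.subset_univ _⟩
  | inter s t _ _ hs ht =>
    obtain ⟨a, ha, ha'⟩ := hs hx.1
    obtain ⟨b, hb, hb'⟩ := ht hx.2
    exact ⟨a ⊓ b, x.inf_mem ha hb, fun z hz =>
      ⟨ha' (z.mem_of_le inf_le_left hz), hb' (z.mem_of_le inf_le_right hz)⟩⟩
  | sUnion S _ ih =>
    obtain ⟨s, hs, hxs⟩ := hx
    obtain ⟨a, ha, ha'⟩ := ih s hs hxs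
    exact ⟨a, ha, ha'.trans (Set.subset_sUnion_of_mem hs)⟩

/-- The characteristic function of the clopen set `[a]`. -/
noncomputable def charFun (a : 𝒜) : C(StoneSpace 𝒜, ℝ) where
  toFun := (basicClopen a).indicator 1
  continuous_toFun := continuous_one.indicator (by simp [(isClopen_basicClopen a).frontier_eq])

lemma charFun_of_mem {a : 𝒜} {x : StoneSpace 𝒜} (h : a ∈ x.carrier) : charFun a x = 1 :=
  Set.indicator_of_mem (s := basicClopen a) h 1

lemma charFun_of_notMem {a : 𝒜} {x : StoneSpace 𝒜} (h : a ∉ x.carrier) : charFun a x = 0 :=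
  Set.indicator_of_notMem (s := basicClopen a) h 1

lemma charFun_sup {a b : 𝒜} (h : Disjoint a b) : charFun (a ⊔ b) = charFun a + charFun b := by
  ext x
  rw [ContinuousMap.add_apply]
  by_cases ha : a ∈ x.carrier
  · rw [charFun_of_mem ha, charFun_of_notMem (notMem_of_disjoint h ha),
      charFun_of_mem (mem_sup_iff.2 (Or.inl ha)), add_zero]
  · by_cases hb : b ∈ x.carrier
    · rw [charFun_of_mem hb, charFun_of_notMem ha, charFun_of_mem (mem_sup_iff.2 (Or.inr hb)),
        zero_add]
    · rw [charFun_of_notMem ha, charFun_of_notMem hb,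
        charFun_of_notMem (by rw [mem_sup_iff]; tauto), add_zero]

/-- On each of the disjoint sets `[f i]`, the step function `∑ c i • χ_[f i]` equals `c i`. -/
lemma sum_smul_charFun_apply {ι : Type*} {s : Finset ι} {f : ι → 𝒜}
    (h : (s : Set ι).PairwiseDisjoint f) (c : ι → ℝ) {i : ι} (hi : i ∈ s) {x : StoneSpace 𝒜}
    (hx : f i ∈ x.carrier) : (∑ j ∈ s, c j • charFun (f j)) x = c i := by
  rw [ContinuousMap.sum_apply, Finset.sum_eq_single_of_mem i hi]
  · simp [charFun_of_mem hx]
  · intro j hj hji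
    simp [charFun_of_notMem (notMem_of_disjoint (h hi hj hji.symm) hx)]

lemma norm_sum_smul_charFun_le {ι : Type*} {s : Finset ι} {f : ι → 𝒜}
    (h : (s : Set ι).PairwiseDisjoint f) {c : ι → ℝ} {C : ℝ} (hC : 0 ≤ C)
    (hc : ∀ i ∈ s, |c i| ≤ C) : ‖∑ j ∈ s, c j • charFun (f j)‖ ≤ C := by
  rw [ContinuousMap.norm_le _ hC]
  intro x
  by_cases hx : ∃ i ∈ s, f i ∈ x.carrier
  · obtain ⟨i, hi, hx⟩ := hx
    rw [sum_smul_charFun_apply h c hi hx]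
    exact hc i hi
  · push Not at hx
    rw [ContinuousMap.sum_apply, Finset.sum_eq_zero, norm_zero]
    · exact hC
    · intro i hi
      simp [charFun_of_notMem (hx i hi)]

/-! ### Step functions over finite partitions -/

lemma exists_mem_parts (P : Finpartition (⊤ : 𝒜)) (x : StoneSpace 𝒜) :
    ∃ p ∈ P.parts, p ∈ x.carrier := by
  have := x.top_mem
  rw [← P.sup_parts, mem_finset_sup_iff] at this
  exact this

lemma exists_finpartition_le_or_le_compl (s : Finset 𝒜) : ∃ P : Finpartition (⊤ : 𝒜),
    ∀ a ∈ s, ∀ p ∈ P.parts, p ≤ a ∨ p ≤ aᶜ := by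
  classical
  induction s using Finset.induction_on with
  | empty => exact ⟨⊤, by simp⟩
  | insert a s _ ih =>
    obtain ⟨P, hP⟩ := ih
    let Q : Finpartition (⊤ : 𝒜) := Finpartition.ofErase {a, aᶜ}
      (by
        rw [Finset.supIndep_iff_pairwiseDisjoint]
        intro b hb c hc hbc
        simp only [Finset.coe_insert, Finset.coe_singleton, Set.mem_insert_iff,
          Set.mem_singleton_iff] at hb hc
        rcases hb with rfl | rfl <;> rcases hc with rfl | rfl
        · exact absurd rfl hbc
        · exact disjoint_compl_right
        · exact disjoint_compl_left
        · exact absurd rfl hbc)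
      (by simp)
    have hPQ : P ⊓ Q ≤ P := inf_le_left
    have hQP : P ⊓ Q ≤ Q := inf_le_right
    refine ⟨P ⊓ Q, fun b hb p hp => ?_⟩
    rcases Finset.mem_insert.1 hb with rfl | hb
    · obtain ⟨c, hc, hpc⟩ := hQP hp
      have hc' := Finset.mem_of_mem_erase hc
      simp only [Finset.mem_insert, Finset.mem_singleton] at hc'
      rcases hc' with rfl | rfl
      · exact Or.inl hpc
      · exact Or.inr hpc
    · obtain ⟨c, hc, hpc⟩ := hPQ hp
      exact (hP b hb c hc).imp hpc.trans hpc.trans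

lemma exists_finpartition_oscillation_le (y : C(StoneSpace 𝒜, ℝ)) {η : ℝ} (hη : 0 < η) :
    ∃ P : Finpartition (⊤ : 𝒜), ∀ p ∈ P.parts, ∀ x x' : StoneSpace 𝒜,
      p ∈ x.carrier → p ∈ x'.carrier → |y x - y x'| ≤ η := by
  classical
  have h (x : StoneSpace 𝒜) : ∃ a ∈ x.carrier, basicClopen a ⊆ y ⁻¹' Metric.ball (y x) (η / 2) :=
    exists_basicClopen_subset (Metric.isOpen_ball.preimage y.continuous)
      (Metric.mem_ball_self (half_pos hη))
  choose a ha ha' using h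
  obtain ⟨t, ht⟩ := isCompact_univ.elim_finite_subcover (fun x : StoneSpace 𝒜 => basicClopen (a x))
    (fun x => isOpen_basicClopen _) (fun x _ => Set.mem_iUnion.2 ⟨x, ha x⟩)
  obtain ⟨P, hP⟩ := exists_finpartition_le_or_le_compl (t.image a)
  refine ⟨P, fun p hp x x' hx hx' => ?_⟩
  obtain ⟨z, hz, hxz⟩ := Set.mem_iUnion₂.1 (ht (Set.mem_univ x))
  have hpz : p ≤ a z := (hP _ (Finset.mem_image_of_mem a hz) p hp).resolve_right fun h =>
    compl_mem_iff.1 (x.mem_of_le h hx) hxz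
  have h1 := ha' z (x.mem_of_le hpz hx)
  have h2 := ha' z (x'.mem_of_le hpz hx')
  rw [Set.mem_preimage, Metric.mem_ball, Real.dist_eq, abs_lt] at h1 h2
  rw [abs_le]
  constructor <;> linarith

/-- The sets `{y ≥ 2 * t}` and `{y < t}` are separated by a clopen set. -/
lemma exists_separating (y : C(StoneSpace 𝒜, ℝ)) {t : ℝ} (ht : 0 < t) :
    ∃ a : 𝒜, (∀ x, a ∉ x.carrier → y x ≤ 2 * t) ∧ ∀ x, a ∈ x.carrier → t ≤ y x := by
  classical
  obtain ⟨P, hP⟩ := exists_finpartition_oscillation_le y ht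
  refine ⟨(P.parts.filter fun p => ∃ x : StoneSpace 𝒜, p ∈ x.carrier ∧ 2 * t ≤ y x).sup id,
    fun x hx => ?_, fun x hx => ?_⟩
  · obtain ⟨p, hp, hpx⟩ := exists_mem_parts P x
    by_contra! h
    exact hx (mem_finset_sup_iff.2 ⟨p, Finset.mem_filter.2 ⟨hp, x, hpx, h.le⟩, hpx⟩)
  · obtain ⟨p, hp, hpx⟩ := mem_finset_sup_iff.1 hx
    obtain ⟨hp, z, hz, hz'⟩ := Finset.mem_filter.1 hp
    have := abs_le.1 (hP p hp x z hpx hz)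
    linarith

open Classical in
/-- Evaluation of continuous functions at a chosen point of `[p]`, or zero if `[p]` is empty. -/
noncomputable def evalOn (p : 𝒜) : StrongDual ℝ C(StoneSpace 𝒜, ℝ) :=
  if h : ∃ x : StoneSpace 𝒜, p ∈ x.carrier then ContinuousMap.evalCLM ℝ h.choose else 0

lemma evalOn_eq {p : 𝒜} (hp : p ≠ ⊥) :
    ∃ x : StoneSpace 𝒜, p ∈ x.carrier ∧ ∀ y, evalOn p y = y x := by
  have h := exists_mem hp
  refine ⟨h.choose, h.choose_spec, fun y => ?_⟩
  rw [evalOn, dif_pos h, ContinuousMap.evalCLM_apply]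

/-- The step function taking on each part `[p]` of the partition `P` a value of `y` on `[p]`. -/
noncomputable def stepApprox (P : Finpartition (⊤ : 𝒜)) (y : C(StoneSpace 𝒜, ℝ)) :
    C(StoneSpace 𝒜, ℝ) :=
  ∑ p ∈ P.parts, evalOn p y • charFun p

lemma tendsto_stepApprox (y : C(StoneSpace 𝒜, ℝ)) :
    Tendsto (fun P => stepApprox P y) atBot (𝓝 y) := by
  classical
  rw [Metric.tendsto_nhds]
  intro η hη
  obtain ⟨P, hP⟩ := exists_finpartition_oscillation_le y (half_pos hη)
  filter_upwards [eventually_le_atBot P] with Q hQ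
  refine lt_of_le_of_lt ?_ (half_lt_self hη)
  rw [ContinuousMap.dist_le (half_pos hη).le]
  intro x
  obtain ⟨q, hq, hqx⟩ := exists_mem_parts Q x
  obtain ⟨p, hp, hqp⟩ := hQ hq
  obtain ⟨z, hz, hyz⟩ := evalOn_eq (Q.ne_bot hq)
  have : stepApprox Q y x = evalOn q y :=
    sum_smul_charFun_apply (f := id) Q.disjoint (fun p => evalOn p y) hq hqx
  rw [this, hyz, Real.dist_eq]
  exact hP p hp z x (z.mem_of_le hqp hz) (x.mem_of_le hqp hqx)

end StoneSpace

/-! ### Integration of continuous functions against finitely additive measures -/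

namespace FinAddSignedMeasure

open StoneSpace

variable {𝒜 : Type*} [BooleanAlgebra 𝒜] (μ : FinAddSignedMeasure 𝒜)

/-- The Riemann sum of `y` for the partition `P`. -/
noncomputable def riemannSum (P : Finpartition (⊤ : 𝒜)) (y : C(StoneSpace 𝒜, ℝ)) : ℝ :=
  ∑ p ∈ P.parts, evalOn p y * μ p

lemma abs_evalOn_le (p : 𝒜) (y : C(StoneSpace 𝒜, ℝ)) : |evalOn p y| ≤ ‖y‖ := by
  by_cases h : ∃ x : StoneSpace 𝒜, p ∈ x.carrier
  · rw [evalOn, dif_pos h, ContinuousMap.evalCLM_apply]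
    exact y.norm_coe_le_norm _
  · simp [evalOn, dif_neg h]

lemma abs_riemannSum_le (P : Finpartition (⊤ : 𝒜)) (y : C(StoneSpace 𝒜, ℝ)) :
    |μ.riemannSum P y| ≤ μ.totalVar ⊤ * ‖y‖ :=
  calc |μ.riemannSum P y| ≤ ∑ p ∈ P.parts, |evalOn p y * μ p| := Finset.abs_sum_le_sum_abs _ _
    _ ≤ ∑ p ∈ P.parts, ‖y‖ * |μ p| := Finset.sum_le_sum fun p _ => by
        rw [abs_mul]
        exact mul_le_mul_of_nonneg_right (abs_evalOn_le p y) (abs_nonneg _)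
    _ = (∑ p ∈ P.parts, |μ p|) * ‖y‖ := by rw [← Finset.mul_sum, mul_comm]
    _ ≤ μ.totalVar ⊤ * ‖y‖ := mul_le_mul_of_nonneg_right
        (μ.sum_abs_le_totalVar P.parts id P.disjoint) (norm_nonneg _)

open Classical in
/-- An ultrafilter on the finite partitions of unity of `𝒜` along which partitions become
arbitrarily fine. Riemann sums converge along the filter `atBot` itself; passing to an ultrafilter
makes the existence of their limits immediate from boundedness. -/
noncomputable def finerUltrafilter (𝒜 : Type*) [BooleanAlgebra 𝒜] :
    Ultrafilter (Finpartition (⊤ : 𝒜)) :=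
  Ultrafilter.of atBot

lemma finerUltrafilter_le : (finerUltrafilter 𝒜 : Filter (Finpartition (⊤ : 𝒜))) ≤ atBot := by
  classical
  exact Ultrafilter.of_le _

lemma exists_tendsto_riemannSum (y : C(StoneSpace 𝒜, ℝ)) :
    ∃ l, Tendsto (fun P => μ.riemannSum P y) (finerUltrafilter 𝒜) (𝓝 l) := by
  have := (isCompact_Icc (a := -(μ.totalVar ⊤ * ‖y‖)) (b := μ.totalVar ⊤ * ‖y‖)).ultrafilter_le_nhds
    ((finerUltrafilter 𝒜).map fun P => μ.riemannSum P y) (by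
      rw [le_principal_iff, Ultrafilter.coe_map, mem_map]
      exact Eventually.of_forall fun P => abs_le.1 (μ.abs_riemannSum_le P y))
  obtain ⟨l, -, hl⟩ := this
  exact ⟨l, hl⟩

/-- The integral of a continuous function on the Stone space against a finitely additive measure,
as a bounded functional: the limit of the Riemann sums over finer and finer partitions. -/
noncomputable def integral : StrongDual ℝ C(StoneSpace 𝒜, ℝ) :=
  LinearMap.mkContinuous
    { toFun := fun y => (μ.exists_tendsto_riemannSum y).choose
      map_add' := fun y z => by
        refine tendsto_nhds_unique (μ.exists_tendsto_riemannSum (y + z)).choose_spec ?_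
        refine ((μ.exists_tendsto_riemannSum y).choose_spec.add
          (μ.exists_tendsto_riemannSum z).choose_spec).congr fun P => ?_
        simp only [riemannSum, ← Finset.sum_add_distrib, map_add, add_mul]
      map_smul' := fun c y => by
        refine tendsto_nhds_unique (μ.exists_tendsto_riemannSum (c • y)).choose_spec ?_
        refine ((μ.exists_tendsto_riemannSum y).choose_spec.const_mul c).congr fun P => ?_
        simp only [riemannSum, Finset.mul_sum, map_smul, smul_eq_mul, mul_assoc] }
    (μ.totalVar ⊤) fun y =>
      le_of_tendsto (μ.exists_tendsto_riemannSum y).choose_spec.abs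
        (Eventually.of_forall fun P => μ.abs_riemannSum_le P y)

lemma tendsto_riemannSum (y : C(StoneSpace 𝒜, ℝ)) :
    Tendsto (fun P => μ.riemannSum P y) (finerUltrafilter 𝒜) (𝓝 (μ.integral y)) :=
  (μ.exists_tendsto_riemannSum y).choose_spec

lemma norm_integral_le : ‖μ.integral‖ ≤ μ.totalVar ⊤ :=
  LinearMap.mkContinuous_norm_le _ (μ.totalVar_nonneg ⊤) _

lemma integral_charFun (a : 𝒜) : μ.integral (charFun a) = μ a := by
  refine tendsto_nhds_unique (μ.tendsto_riemannSum _) (tendsto_const_nhds.congr' ?_)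
  obtain ⟨Q, hQ⟩ := exists_finpartition_le_or_le_compl {a}
  refine finerUltrafilter_le ?_
  filter_upwards [eventually_le_atBot Q] with P hP
  rw [← μ.sum_parts_inf P a]
  refine Finset.sum_congr rfl fun p hp => ?_
  obtain ⟨q, hq, hpq⟩ := hP hp
  obtain ⟨x, hx, hpx⟩ := evalOn_eq (P.ne_bot hp)
  rw [hpx]
  rcases hQ a (Finset.mem_singleton_self a) q hq with h | h
  · rw [charFun_of_mem (x.mem_of_le (hpq.trans h) hx), inf_eq_left.2 (hpq.trans h), one_mul]
  · rw [charFun_of_notMem (compl_mem_iff.1 (x.mem_of_le (hpq.trans h) hx)), zero_mul,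
      (disjoint_compl_left.mono_left (hpq.trans h)).eq_bot, map_bot]

lemma integral_mono (hμ : ∀ a, 0 ≤ μ a) {y z : C(StoneSpace 𝒜, ℝ)} (h : ∀ x, y x ≤ z x) :
    μ.integral y ≤ μ.integral z := by
  refine le_of_tendsto_of_tendsto' (μ.tendsto_riemannSum y) (μ.tendsto_riemannSum z) fun P => ?_
  refine Finset.sum_le_sum fun p hp => mul_le_mul_of_nonneg_right ?_ (hμ p)
  obtain ⟨x, -, hx⟩ := evalOn_eq (P.ne_bot hp)
  rw [hx, hx]
  exact h x

/-- The finitely additive measure `a ↦ h χ_[a]` represented by a functional `h`. -/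
noncomputable def ofDual (h : StrongDual ℝ C(StoneSpace 𝒜, ℝ)) : FinAddSignedMeasure 𝒜 where
  toFun a := h (charFun a)
  map_sup_of_disjoint a b hab := by rw [charFun_sup hab, map_add]
  bounded := by
    refine ⟨‖h‖, fun a => ?_⟩
    have h1 : ‖charFun a‖ ≤ 1 := by
      rw [ContinuousMap.norm_le _ zero_le_one]
      intro x
      by_cases hx : a ∈ x.carrier
      · simp [charFun_of_mem hx]
      · simp [charFun_of_notMem hx]
    exact (h.le_opNorm _).trans (mul_le_of_le_one_right (norm_nonneg _) h1)

lemma sum_abs_ofDual_le (h : StrongDual ℝ C(StoneSpace 𝒜, ℝ)) {ι : Type*} (s : Finset ι)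
    (f : ι → 𝒜) (hf : (s : Set ι).PairwiseDisjoint f) : ∑ i ∈ s, |h (charFun (f i))| ≤ ‖h‖ := by
  have h1 : ∑ i ∈ s, |h (charFun (f i))|
      = h (∑ i ∈ s, (SignType.sign (h (charFun (f i))) : ℝ) • charFun (f i)) := by
    rw [map_sum]
    refine Finset.sum_congr rfl fun i _ => ?_
    rw [map_smul, smul_eq_mul, sign_mul_self]
  rw [h1]
  refine (le_abs_self _).trans ((h.le_opNorm _).trans
    (mul_le_of_le_one_right (norm_nonneg _) (norm_sum_smul_charFun_le hf zero_le_one ?_)))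
  intro i _
  rcases SignType.sign (h (charFun (f i))) with _ | _ | _ <;> simp

lemma variation_ofDual_le (h : StrongDual ℝ C(StoneSpace 𝒜, ℝ)) :
    (ofDual h).variation ≤ ‖h‖₊ := by
  refine iSup₂_le fun s hs => ?_
  rw [← ENNReal.ofReal_sum_of_nonneg fun _ _ => abs_nonneg _, ENNReal.ofReal_le_coe]
  exact sum_abs_ofDual_le h s id hs

lemma abs_apply_le_integral_totalVar (h : StrongDual ℝ C(StoneSpace 𝒜, ℝ))
    (y : C(StoneSpace 𝒜, ℝ)) : |h y| ≤ (ofDual h).totalVar.integral |y| := by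
  have h1 : Tendsto (fun P => |h (stepApprox P y)|) (finerUltrafilter 𝒜) (𝓝 |h y|) :=
    (((h.continuous.tendsto y).comp (tendsto_stepApprox y)).mono_left finerUltrafilter_le).abs
  refine le_of_tendsto_of_tendsto' h1 ((ofDual h).totalVar.tendsto_riemannSum _) fun P => ?_
  rw [stepApprox, map_sum]
  refine (Finset.abs_sum_le_sum_abs _ _).trans (Finset.sum_le_sum fun p hp => ?_)
  obtain ⟨x, -, hx⟩ := evalOn_eq (P.ne_bot hp)
  rw [map_smul, smul_eq_mul, abs_mul, hx, hx]
  exact mul_le_mul_of_nonneg_left ((ofDual h).abs_le_totalVar p) (abs_nonneg _)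

end FinAddSignedMeasure

/-! ### Weak convergence along disjoint clopen sets -/

/-- A diagonal form of Schur's theorem for `ℓ¹`, proved by a sliding hump: rows of summable
sequences whose sums over every fixed set of indices tend to zero have diagonal tending to zero. -/
lemma tendsto_diagonal_of_tendsto_tsum_indicator {x : ℕ → ℕ → ℝ} (hs : ∀ n, Summable (x n))
    (h : ∀ S : Set ℕ, Tendsto (fun n => ∑' k, S.indicator (x n) k) atTop (𝓝 0)) :
    Tendsto (fun n => x n n) atTop (𝓝 0) := by
  by_contra hcon
  obtain ⟨ε, hε, hfreq⟩ : ∃ ε > 0, ∃ᶠ n in atTop, ε ≤ |x n n| := by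
    rw [Metric.tendsto_nhds] at hcon
    push Not at hcon
    obtain ⟨ε, hε, hfreq⟩ := hcon
    exact ⟨ε, hε, by simpa using hfreq⟩
  have hcoord (k : ℕ) : Tendsto (fun n => |x n k|) atTop (𝓝 0) := by
    have := (h {k}).abs
    rw [abs_zero] at this
    refine this.congr fun n => ?_
    rw [tsum_eq_single k fun j hj => Set.indicator_of_notMem (by simpa using hj) _,
      Set.indicator_of_mem (Set.mem_singleton k)]
  have hnext (N : ℕ) : ∃ n, N < n ∧ ε ≤ |x n n| ∧ ∑ k ∈ Finset.range (N + 1), |x n k| < ε / 4 ∧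
      ∑' k, |x N (k + n)| < ε / 4 := by
    have h1 : Tendsto (fun n => ∑ k ∈ Finset.range (N + 1), |x n k|) atTop (𝓝 0) := by
      simpa using tendsto_finsetSum (Finset.range (N + 1)) fun k _ => hcoord k
    have h2 : Tendsto (fun n => ∑' k, |x N (k + n)|) atTop (𝓝 0) :=
      tendsto_sum_nat_add fun k => |x N k|
    have hε4 : 0 < ε / 4 := by positivity
    obtain ⟨n, hn, h3, h4, h5⟩ := (hfreq.and_eventually ((eventually_gt_atTop N).and
      ((h1.eventually_lt_const hε4).and (h2.eventually_lt_const hε4)))).exists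
    exact ⟨n, h3, hn, h4, h5⟩
  choose next hlt hbig hhead htail using hnext
  let s : ℕ → ℕ := fun i => Nat.rec 0 (fun _ N => next N) i
  have hmono : StrictMono s := strictMono_nat_of_lt_succ fun i => hlt (s i)
  -- On the range of `s` the row `s (i + 1)` has a hump of height `ε` at its diagonal entry.
  have key (i : ℕ) : ε / 2 ≤ |∑' k, (Set.range s).indicator (x (s (i + 1))) k| := by
    set n := s (i + 1) with hn
    set g := (Set.range s).indicator (x n) with hg
    have hgle (k : ℕ) : |g k| ≤ |x n k| := by
      by_cases hk : k ∈ Set.range s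
      · rw [hg, Set.indicator_of_mem hk]
      · rw [hg, Set.indicator_of_notMem hk, abs_zero]
        exact abs_nonneg _
    have hgs : Summable g := (hs n).indicator _
    have hzero {j k : ℕ} (h1 : s j < k) (h2 : k < s (j + 1)) : g k = 0 := by
      refine Set.indicator_of_notMem ?_ _
      rintro ⟨m, rfl⟩
      exact absurd (hmono.lt_iff_lt.1 h2) (not_lt.2 (hmono.lt_iff_lt.1 h1))
    have hsplit := hgs.sum_add_tsum_nat_add (s (i + 2))
    have h1 : ∑ k ∈ Finset.range (s (i + 2)), g k = ∑ k ∈ Finset.range (n + 1), g k := by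
      refine (Finset.sum_subset ?_ ?_).symm
      · exact Finset.range_subset_range.2 (hmono (Nat.lt_succ_self (i + 1)))
      · intro k hk hk'
        rw [Finset.mem_range] at hk hk'
        exact hzero (j := i + 1) (by omega) hk
    have h2 : ∑ k ∈ Finset.range n, g k = ∑ k ∈ Finset.range (s i + 1), g k := by
      refine (Finset.sum_subset ?_ ?_).symm
      · exact Finset.range_subset_range.2 (hmono (Nat.lt_succ_self i))
      · intro k hk hk'
        rw [Finset.mem_range] at hk hk'
        exact hzero (j := i) (by omega) hk
    have h3 : |∑ k ∈ Finset.range (s i + 1), g k| < ε / 4 :=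
      ((Finset.abs_sum_le_sum_abs _ _).trans (Finset.sum_le_sum fun k _ => hgle k)).trans_lt
        (hhead (s i))
    have h4 : |∑' k, g (k + s (i + 2))| < ε / 4 := by
      have hx : Summable fun k => |x n (k + s (i + 2))| :=
        (summable_nat_add_iff (f := fun k => |x n k|) _).2 (hs n).abs
      have hg' : Summable fun k => |g (k + s (i + 2))| :=
        (summable_nat_add_iff (f := fun k => |g k|) _).2 hgs.abs
      refine lt_of_le_of_lt ?_ (htail n)
      have := norm_tsum_le_tsum_norm (f := fun k => g (k + s (i + 2))) hg'
      exact this.trans (hg'.tsum_le_tsum (fun k => hgle _) hx)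
    have h5 : g n = x n n := Set.indicator_of_mem (Set.mem_range_self (i + 1)) _
    have h6 : ε ≤ |x n n| := hbig (s i)
    rw [h1, Finset.sum_range_succ, h2, h5] at hsplit
    rw [← hsplit]
    have h7 := abs_lt.1 h3
    have h8 := abs_lt.1 h4
    rcases le_abs.1 h6 with h9 | h9
    · exact le_abs.2 (Or.inl (by linarith))
    · exact le_abs.2 (Or.inr (by linarith))
  have hlim := ((h (Set.range s)).comp (hmono.tendsto_atTop.comp (tendsto_add_atTop_nat 1))).abs
  rw [abs_zero] at hlim
  have := ge_of_tendsto' hlim key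
  linarith

namespace FinAddSignedMeasure

open StoneSpace

variable {𝒜 : Type*} [BooleanAlgebra 𝒜]

lemma tendsto_integral {μ : ℕ → FinAddSignedMeasure 𝒜} {ν : FinAddSignedMeasure 𝒜} {K : ℝ}
    (hK : ∀ n, ‖(μ n).integral‖ ≤ K) (h : ∀ a, Tendsto (fun n => μ n a) atTop (𝓝 (ν a)))
    (y : C(StoneSpace 𝒜, ℝ)) :
    Tendsto (fun n => (μ n).integral y) atTop (𝓝 (ν.integral y)) := by
  classical
  have hK0 : 0 ≤ K := (norm_nonneg (μ 0).integral).trans (hK 0)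
  rw [Metric.tendsto_atTop]
  intro ε hε
  have hL : 0 < 2 * (K + ‖ν.integral‖ + 1) := by positivity
  obtain ⟨P, hP⟩ := ((Metric.tendsto_nhds.1 (tendsto_stepApprox y))
    (ε / (2 * (K + ‖ν.integral‖ + 1))) (by positivity)).exists
  rw [dist_comm, dist_eq_norm, lt_div_iff₀ hL] at hP
  set z := stepApprox P y with hz
  have hstep (ρ : FinAddSignedMeasure 𝒜) :
      ρ.integral z = ∑ p ∈ P.parts, evalOn p y * ρ p := by
    rw [hz, stepApprox, map_sum]
    exact Finset.sum_congr rfl fun p _ => by rw [map_smul, integral_charFun, smul_eq_mul]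
  have h1 : Tendsto (fun n => (μ n).integral z) atTop (𝓝 (ν.integral z)) := by
    simp only [hstep]
    exact tendsto_finsetSum _ fun p _ => (h p).const_mul _
  obtain ⟨N, hN⟩ := Metric.tendsto_atTop.1 h1 (ε / 2) (half_pos hε)
  refine ⟨N, fun n hn => ?_⟩
  have h2 := hN n hn
  have h3 : |(μ n).integral (y - z)| ≤ K * ‖y - z‖ := (μ n).integral.le_of_opNorm_le (hK n) _
  have h4 : |ν.integral (y - z)| ≤ ‖ν.integral‖ * ‖y - z‖ := ν.integral.le_opNorm _
  rw [map_sub] at h3 h4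
  rw [Real.dist_eq] at h2 ⊢
  have h5 := abs_lt.1 h2
  have h6 := abs_le.1 h3
  have h7 := abs_le.1 h4
  have h8 := norm_nonneg (y - z)
  rw [abs_lt]
  constructor <;> nlinarith

lemma summable_abs_dual_charFun {A : ℕ → 𝒜} (hA : Pairwise fun m n => Disjoint (A m) (A n))
    (φ : StrongDual ℝ C(StoneSpace 𝒜, ℝ)) : Summable fun k => |φ (charFun (A k))| :=
  summable_of_sum_le (fun _ => abs_nonneg _) fun s =>
    sum_abs_ofDual_le φ s A fun _ _ _ _ hij => hA hij

lemma summable_indicator_dual_charFun {A : ℕ → 𝒜}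
    (hA : Pairwise fun m n => Disjoint (A m) (A n)) (S : Set ℕ)
    (φ : StrongDual ℝ C(StoneSpace 𝒜, ℝ)) :
    Summable (S.indicator fun k => φ (charFun (A k))) :=
  (summable_abs_dual_charFun hA φ).of_abs.indicator S

lemma abs_tsum_indicator_le {A : ℕ → 𝒜} (hA : Pairwise fun m n => Disjoint (A m) (A n))
    (S : Set ℕ) (φ : StrongDual ℝ C(StoneSpace 𝒜, ℝ)) :
    |∑' k, S.indicator (fun k => φ (charFun (A k))) k| ≤ ‖φ‖ := by
  have hs := summable_abs_dual_charFun hA φ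
  set g : ℕ → ℝ := S.indicator fun k => φ (charFun (A k)) with hg
  have hle (k : ℕ) : ‖g k‖ ≤ |φ (charFun (A k))| := by
    by_cases hk : k ∈ S <;> simp [hg, hk]
  have h1 : ‖∑' k, g k‖ ≤ ∑' k, |φ (charFun (A k))| := tsum_of_norm_bounded hs.hasSum hle
  exact h1.trans (hs.tsum_le_of_sum_le fun s =>
    sum_abs_ofDual_le φ s A fun i _ j _ hij => hA hij)

/-- For disjoint `A k`, the functional `φ ↦ ∑ k ∈ S, φ χ_[A k]` on the dual of `C(K)`. It plays the
role of the value of the measure `φ` on the open set `⋃ k ∈ S, [A k]`. -/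
noncomputable def bidualUnion {A : ℕ → 𝒜} (hA : Pairwise fun m n => Disjoint (A m) (A n))
    (S : Set ℕ) : StrongDual ℝ (StrongDual ℝ C(StoneSpace 𝒜, ℝ)) :=
  LinearMap.mkContinuous
    { toFun := fun φ : StrongDual ℝ C(StoneSpace 𝒜, ℝ) => ∑' k, S.indicator (fun k => φ (charFun (A k))) k
      map_add' := fun φ ψ => by
        rw [← (summable_indicator_dual_charFun hA S φ).tsum_add
          (summable_indicator_dual_charFun hA S ψ)]
        refine tsum_congr fun k => ?_
        by_cases hk : k ∈ S <;> simp [hk]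
      map_smul' := fun c φ => by
        rw [RingHom.id_apply, smul_eq_mul, ← tsum_mul_left]
        refine tsum_congr fun k => ?_
        by_cases hk : k ∈ S <;> simp [hk] }
    1 fun φ => (abs_tsum_indicator_le hA S φ).trans (one_mul _).ge

lemma bidualUnion_apply {A : ℕ → 𝒜} (hA : Pairwise fun m n => Disjoint (A m) (A n)) (S : Set ℕ)
    (φ : StrongDual ℝ C(StoneSpace 𝒜, ℝ)) :
    bidualUnion hA S φ = ∑' k, S.indicator (fun k => φ (charFun (A k))) k := rfl

/-- Under weak convergence in the dual, the values on a disjoint sequence vanish diagonally. -/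
lemma tendsto_diagonal_of_weak {A : ℕ → 𝒜} (hA : Pairwise fun m n => Disjoint (A m) (A n))
    {f : ℕ → StrongDual ℝ C(StoneSpace 𝒜, ℝ)} {g : StrongDual ℝ C(StoneSpace 𝒜, ℝ)}
    (h : ∀ F : StrongDual ℝ (StrongDual ℝ C(StoneSpace 𝒜, ℝ)),
      Tendsto (fun n => F (f n)) atTop (𝓝 (F g))) :
    Tendsto (fun n => f n (charFun (A n))) atTop (𝓝 0) := by
  have h1 : Tendsto (fun n => (f n - g) (charFun (A n))) atTop (𝓝 0) := by
    refine tendsto_diagonal_of_tendsto_tsum_indicator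
      (x := fun n k => (f n - g) (charFun (A k)))
      (fun n => (summable_abs_dual_charFun hA (f n - g)).of_abs) fun S => ?_
    have := (h (bidualUnion hA S)).sub_const (bidualUnion hA S g)
    rw [sub_self] at this
    refine this.congr fun n => ?_
    rw [← map_sub, bidualUnion_apply]
  have h2 := (summable_abs_dual_charFun hA g).of_abs.tendsto_atTop_zero
  have h3 := h1.add h2
  rw [add_zero] at h3
  refine h3.congr fun n => ?_
  rw [sub_apply, sub_add_cancel]

end FinAddSignedMeasure

/-! ### Uniformly exhaustive families -/

namespace FinAddSignedMeasure

variable {𝒜 : Type*} [BooleanAlgebra 𝒜]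

/-- A family of finitely additive measures, meant to be nonnegative, is uniformly exhaustive if
along each disjoint sequence its values become uniformly small. Smallness at a single index is
required, which by passing to subsequences is equivalent to smallness at all large indices. -/
def UniformlyExhaustive {ι : Type*} (v : ι → FinAddSignedMeasure 𝒜) : Prop :=
  ∀ C : ℕ → 𝒜, (Pairwise fun m n => Disjoint (C m) (C n)) → ∀ ε > 0, ∃ k, ∀ n, v n (C k) ≤ ε

lemma pairwise_disjoint_of_lt {C : ℕ → 𝒜} (h : ∀ i j, i < j → Disjoint (C i) (C j)) :
    Pairwise fun m n => Disjoint (C m) (C n) := fun i j hij =>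
  (lt_or_gt_of_ne hij).elim (h i j) fun hji => (h j i hji).symm

lemma UniformlyExhaustive.exists_sdiff_le {ι : Type*} {v : ι → FinAddSignedMeasure 𝒜}
    (hv : UniformlyExhaustive v) {U : ℕ → 𝒜} (hU : Monotone U) {ε : ℝ} (hε : 0 < ε) :
    ∃ M, ∀ m ≥ M, ∀ n, v n (U m \ U M) ≤ ε := by
  by_contra! hcon
  choose m hm n hn using hcon
  let s : ℕ → ℕ := fun i => Nat.rec 0 (fun _ N => m N) i
  have hmono : Monotone s := monotone_nat_of_le_succ fun i => hm (s i)
  obtain ⟨k, hk⟩ := hv (fun i => U (s (i + 1)) \ U (s i))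
    (pairwise_disjoint_of_lt fun i j hij =>
      disjoint_sdiff_self_right.mono_left (sdiff_le.trans (hU (hmono hij)))) ε hε
  exact absurd (hk (n (s k))) (not_le.2 (hn (s k)))

/-- Uniform exhaustivity implies uniform absolute continuity with respect to a finite subfamily, up
to a given error. Otherwise there are `a k` and `n k` with `v (n k) (a k) > ε` but `v (n j) (a k)`
tiny for `j < k`. By exhaustivity, a finite join `V k` of elements `a j` with `j > k` almost
contains all of them, so the elements `(a k ⊓ ⨅ i < k, V i) \ V k` are disjoint and carry most of
the mass of `v (n k)` on `a k`. -/
lemma UniformlyExhaustive.exists_control {v : ℕ → FinAddSignedMeasure 𝒜}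
    (hv : UniformlyExhaustive v) (hpos : ∀ n a, 0 ≤ v n a) {ε : ℝ} (hε : 0 < ε) :
    ∃ N : ℕ, ∃ η > 0, ∀ a, (∀ j < N, v j a < η) → ∀ n, v n a ≤ ε := by
  by_contra! hcon
  have hη (k : ℕ) : 0 < ε / 8 * (1 / 2) ^ k := by positivity
  choose b hb m hm using fun N => hcon N _ (hη N)
  let s : ℕ → ℕ := fun i => Nat.rec 0 (fun _ N => max N (m N) + 1) i
  have hs_succ (i : ℕ) : s (i + 1) = max (s i) (m (s i)) + 1 := rfl
  have hmono : StrictMono s := strictMono_nat_of_lt_succ fun i => by rw [hs_succ]; omega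
  let a : ℕ → 𝒜 := fun k => b (s k)
  let n : ℕ → ℕ := fun k => m (s k)
  have hbig (k : ℕ) : ε < v (n k) (a k) := hm (s k)
  have hsmall {j k : ℕ} (hjk : j < k) : v (n j) (a k) ≤ ε / 8 * (1 / 2) ^ k := by
    have h1 : n j < s k := by
      have := hmono.monotone (Nat.succ_le_of_lt hjk)
      rw [Nat.succ_eq_add_one, hs_succ] at this
      have h2 : n j ≤ max (s j) (m (s j)) := le_max_right _ _
      omega
    refine (hb (s k) (n j) h1).le.trans (mul_le_mul_of_nonneg_left ?_ (by positivity))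
    exact pow_le_pow_of_le_one (by norm_num) (by norm_num) (hmono.id_le k)
  -- Sums of the tolerances over any finite set of indices.
  have hgeom (t : Finset ℕ) : ∑ i ∈ t, ε / 8 * (1 / 2 : ℝ) ^ i ≤ ε / 4 := by
    rw [← Finset.mul_sum]
    have := summable_geometric_two.sum_le_tsum t fun i _ => by positivity
    rw [tsum_geometric_two] at this
    nlinarith
  have hU (k : ℕ) : Monotone fun l => (Finset.Ioc k l).sup a := fun l l' h =>
    Finset.sup_mono (Finset.Ioc_subset_Ioc_right h)
  choose M hM using fun k => hv.exists_sdiff_le (hU k) (hη k)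
  let V : ℕ → 𝒜 := fun k => (Finset.Ioc k (M k)).sup a
  have hV (k : ℕ) : v (n k) (V k) ≤ ε / 4 :=
    (map_finset_sup_le (hpos _) _ _).trans ((Finset.sum_le_sum fun j hj =>
      hsmall (Finset.mem_Ioc.1 hj).1).trans (hgeom _))
  have hsdiff {i k : ℕ} (hik : i < k) (l : ℕ) : v l (a k \ V i) ≤ ε / 8 * (1 / 2) ^ i := by
    refine (mono (hpos l) ?_).trans (hM i (max k (M i)) (le_max_right _ _) l)
    exact sdiff_le_sdiff_right
      (Finset.le_sup (f := a) (Finset.mem_Ioc.2 ⟨hik, le_max_left _ _⟩))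
  let C : ℕ → 𝒜 := fun k => (a k ⊓ (Finset.range k).inf V) \ V k
  have hC : Pairwise fun i j => Disjoint (C i) (C j) := pairwise_disjoint_of_lt fun i j hij =>
    disjoint_sdiff_self_left.mono_right
      (sdiff_le.trans (inf_le_right.trans (Finset.inf_le (Finset.mem_range.2 hij))))
  obtain ⟨k, hk⟩ := hv C hC (ε / 4) (by positivity)
  have hcover : a k ≤ C k ⊔ V k ⊔ (Finset.range k).sup fun i => a k \ V i := by
    have h1 : (Finset.range k).sup (fun i => a k \ V i) = a k \ (Finset.range k).inf V := by
      simp only [sdiff_eq, Finset.compl_inf, Finset.sup_inf_distrib_left]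
    have h2 : C k ⊔ V k = (a k ⊓ (Finset.range k).inf V) ⊔ V k := sdiff_sup_self _ _
    rw [h1, h2]
    calc a k = (a k ⊓ (Finset.range k).inf V) ⊔ a k \ (Finset.range k).inf V :=
          (sup_inf_sdiff _ _).symm
      _ ≤ _ := sup_le_sup_right le_sup_left _
  have h1 := mono (hpos (n k)) hcover
  have h2 := map_sup_le (hpos (n k)) (C k ⊔ V k) ((Finset.range k).sup fun i => a k \ V i)
  have h3 := map_sup_le (hpos (n k)) (C k) (V k)
  have h4 : v (n k) ((Finset.range k).sup fun i => a k \ V i) ≤ ε / 4 :=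
    (map_finset_sup_le (hpos _) _ _).trans ((Finset.sum_le_sum fun i hi =>
      hsdiff (Finset.mem_range.1 hi) (n k)).trans (hgeom _))
  linarith [hbig k, hV k, hk (n k)]

end FinAddSignedMeasure

/-! ### Weakly null sequences in the dual -/

/-- A finite form of Goldstine's theorem: finitely many strict lower bounds satisfied by a bidual
element of norm at most one are satisfied, up to a factor, by an element of the unit ball. -/
lemma exists_norm_le_one_forall_le_apply {X : Type*} [NormedAddCommGroup X] [NormedSpace ℝ X]
    {ι : Type*} [Fintype ι] (h : ι → StrongDual ℝ X) (F : StrongDual ℝ (StrongDual ℝ X))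
    (hF : ‖F‖ ≤ 1) {δ : ℝ} (hδ : 0 < δ) (hFh : ∀ i, 2 * δ ≤ F (h i)) :
    ∃ y : X, ‖y‖ ≤ 1 ∧ ∀ i, δ ≤ h i y := by
  classical
  by_contra! hcon
  let T : X →L[ℝ] (ι → ℝ) := ContinuousLinearMap.pi h
  obtain ⟨f, u, hfu, huf⟩ := geometric_hahn_banach_open
    (s := Set.pi Set.univ fun _ : ι => Set.Ioi δ) (t := T '' Metric.closedBall 0 1)
    (convex_pi fun _ _ => convex_Ioi δ) (isOpen_set_pi Set.finite_univ fun _ _ => isOpen_Ioi)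
    ((convex_closedBall 0 1).linear_image (T : X →ₗ[ℝ] (ι → ℝ)))
    (by
      rw [Set.disjoint_left]
      rintro _ hv ⟨y, hy, rfl⟩
      obtain ⟨i, hi⟩ := hcon y (by simpa using hy)
      have : δ < h i y := hv i (Set.mem_univ i)
      linarith)
  let c : ι → ℝ := fun i => -f (Pi.single i 1)
  have hf (v : ι → ℝ) : f v = -∑ i, v i * c i := by
    conv_lhs => rw [pi_eq_sum_univ' v]
    rw [map_sum, ← Finset.sum_neg_distrib]
    refine Finset.sum_congr rfl fun i _ => ?_
    rw [map_smul, smul_eq_mul]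
    simp only [c, mul_neg, neg_neg]
  have hu : -u < ∑ i, 3 / 2 * δ * c i := by
    have := hfu (fun _ => 3 / 2 * δ) fun i _ => Set.mem_Ioi.2 (by linarith)
    rw [hf] at this
    linarith
  have hc (i : ι) : 0 ≤ c i := by
    by_contra! hci
    obtain ⟨r, hr⟩ := exists_nat_gt ((∑ i, 3 / 2 * δ * c i + u) / -c i)
    have := hfu ((fun _ => 3 / 2 * δ) + (r : ℝ) • Pi.single i 1) fun j _ => by
      have h0 : (0 : ℝ) ≤ r * (Pi.single i 1 : ι → ℝ) j :=
        by
        rw [Pi.single_apply]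
        split_ifs <;> simp
      rw [Set.mem_Ioi, Pi.add_apply, Pi.smul_apply, smul_eq_mul]
      linarith
    rw [map_add, map_smul, hf, smul_eq_mul] at this
    rw [div_lt_iff₀ (by linarith)] at hr
    have h1 : f (Pi.single i 1) = -c i := (neg_neg _).symm
    rw [h1] at this
    linarith
  let G : StrongDual ℝ X := ∑ i, c i • h i
  have hG (y : X) (hy : ‖y‖ ≤ 1) : G y ≤ -u := by
    have := huf (T y) ⟨y, by simpa using hy, rfl⟩
    rw [hf] at this
    have h1 : G y = ∑ i, T y i * c i := by
      simp only [G, sum_apply, smul_apply, smul_eq_mul, mul_comm (c _)]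
      rfl
    linarith
  have hGn : ‖G‖ ≤ -u := by
    refine ContinuousLinearMap.opNorm_le_of_unit_norm (by simpa using hG 0 (by simp)) fun y hy => ?_
    rw [Real.norm_eq_abs, abs_le]
    have := hG (-y) (by rw [norm_neg, hy])
    rw [map_neg] at this
    exact ⟨by linarith, hG y hy.le⟩
  have hFG : ∑ i, 2 * δ * c i ≤ F G := by
    simp only [G, map_sum, map_smul, smul_eq_mul]
    exact Finset.sum_le_sum fun i _ => by
      rw [mul_comm]
      exact mul_le_mul_of_nonneg_left (hFh i) (hc i)
  have hFG' : F G ≤ ‖G‖ :=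
    (le_abs_self _).trans ((F.le_opNorm G).trans (mul_le_of_le_one_left (norm_nonneg _) hF))
  rw [← Finset.mul_sum] at hFG hu
  have := Finset.sum_nonneg fun i (_ : i ∈ Finset.univ) => hc i
  nlinarith

/-- A sequence of functionals is weakly null if no subsequence is bounded below by a positive
constant, on each of its initial segments, at a suitable point of the unit ball. -/
lemma tendsto_bidual_apply_of_forall_subsequence {X : Type*} [NormedAddCommGroup X]
    [NormedSpace ℝ X] {h : ℕ → StrongDual ℝ X}
    (hh : ∀ φ : ℕ → ℕ, StrictMono φ → ∀ δ > 0, ∃ m, ∀ y, ‖y‖ ≤ 1 → ∃ i ≤ m, h (φ i) y < δ)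
    (F : StrongDual ℝ (StrongDual ℝ X)) : Tendsto (fun n => F (h n)) atTop (𝓝 0) := by
  have key (G : StrongDual ℝ (StrongDual ℝ X)) (hG : ‖G‖ ≤ 1) {δ : ℝ}
      (hδ : 0 < δ) : ∀ᶠ n in atTop, G (h n) < 2 * δ := by
    by_contra hcon
    rw [not_eventually] at hcon
    obtain ⟨φ, hφ, hφ'⟩ := extraction_of_frequently_atTop hcon
    obtain ⟨m, hm⟩ := hh φ hφ δ hδ
    obtain ⟨y, hy, hy'⟩ := exists_norm_le_one_forall_le_apply (fun i : Fin (m + 1) => h (φ i)) G hG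
      hδ fun i => not_lt.1 (hφ' i)
    obtain ⟨i, hi, hi'⟩ := hm y hy
    exact absurd (hy' ⟨i, Nat.lt_succ_of_le hi⟩) (not_le.2 hi')
  have hK : 0 < ‖F‖ + 1 := by positivity
  rw [Metric.tendsto_nhds]
  intro ε hε
  have hG (c : ℝ) (hc : |c| = (‖F‖ + 1)⁻¹) : ‖c • F‖ ≤ 1 := by
    refine ContinuousLinearMap.opNorm_le_bound _ zero_le_one fun x => ?_
    have h1 := F.le_opNorm x
    rw [smul_apply, norm_smul, Real.norm_eq_abs c, hc, one_mul, inv_mul_le_iff₀ hK]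
    linarith [norm_nonneg x]
  have hδ : 0 < ε / (2 * (‖F‖ + 1)) := by positivity
  have h2δ : (‖F‖ + 1) * (2 * (ε / (2 * (‖F‖ + 1)))) = ε := by field_simp
  filter_upwards [key ((‖F‖ + 1)⁻¹ • F) (hG _ (abs_of_pos (by positivity))) hδ,
    key (-(‖F‖ + 1)⁻¹ • F) (hG _ (by rw [abs_neg, abs_of_pos (by positivity)])) hδ] with n h1 h2
  rw [smul_apply, smul_eq_mul] at h1 h2
  rw [neg_mul, ← mul_neg] at h2
  rw [inv_mul_lt_iff₀ hK, h2δ] at h1 h2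
  rw [dist_zero_right, Real.norm_eq_abs, abs_lt]
  constructor <;> linarith

/-- In a decreasing sequence of midpoint-convex sets, near-minimizers of a nonnegative function
satisfying the parallelogram identity form a Cauchy sequence. -/
lemma exists_forall_exists_sub_lt_of_parallelogram {X : Type*} [AddCommGroup X] [Module ℝ X]
    {q : X → ℝ} (hq : ∀ y, 0 ≤ q y)
    (hpar : ∀ y z, q (y - z) = 2 * q y + 2 * q z - 4 * q ((1 / 2 : ℝ) • (y + z)))
    {C : ℕ → Set X} (hC : Antitone C) (hne : ∀ m, (C m).Nonempty)
    (hmid : ∀ m, ∀ y ∈ C m, ∀ z ∈ C m, (1 / 2 : ℝ) • (y + z) ∈ C m) {B : ℝ}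
    (hB : ∀ y ∈ C 0, q y ≤ B) {κ : ℝ} (hκ : 0 < κ) :
    ∃ m, ∃ y ∈ C m, ∀ k ≥ m, ∃ z ∈ C k, q (y - z) < 8 * κ := by
  let d : ℕ → ℝ := fun m => sInf (q '' C m)
  have hbelow (m : ℕ) : BddBelow (q '' C m) := ⟨0, by rintro _ ⟨y, _, rfl⟩; exact hq y⟩
  have hd {m : ℕ} {y : X} (hy : y ∈ C m) : d m ≤ q y := csInf_le (hbelow m) ⟨y, hy, rfl⟩
  have hdB : BddAbove (Set.range d) := by
    refine ⟨B, ?_⟩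
    rintro _ ⟨m, rfl⟩
    obtain ⟨y, hy⟩ := hne m
    exact (hd hy).trans (hB y (hC (Nat.zero_le m) hy))
  obtain ⟨m, hm⟩ := exists_lt_of_lt_ciSup (sub_lt_self (⨆ i, d i) hκ)
  have hnear (k : ℕ) : ∃ y ∈ C k, q y < (⨆ i, d i) + κ := by
    obtain ⟨_, ⟨y, hy, rfl⟩, hyd⟩ := exists_lt_of_csInf_lt ((hne k).image q)
      (show d k < d k + κ by linarith)
    exact ⟨y, hy, by linarith [le_ciSup hdB k]⟩
  obtain ⟨y, hy, hyd⟩ := hnear m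
  refine ⟨m, y, hy, fun k hk => ?_⟩
  obtain ⟨z, hz, hzd⟩ := hnear k
  refine ⟨z, hz, ?_⟩
  rw [hpar]
  linarith [hd (hmid m y hy z (hC hk hz))]

namespace FinAddSignedMeasure

open StoneSpace

variable {𝒜 : Type*} [BooleanAlgebra 𝒜]

/-- Chebyshev's inequality: if the measure `v` dominating `h` is small on the elements where `l` is
small, then `h` is small on functions that are small in `L²(l)`. -/
lemma abs_apply_le_of_integral_mul_self_lt {l : FinAddSignedMeasure 𝒜} (hl : ∀ a, 0 ≤ l a)
    (h : StrongDual ℝ C(StoneSpace 𝒜, ℝ)) {ε η t : ℝ} (ht : 0 < t)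
    (hc : ∀ a, l a < η → (ofDual h).totalVar a ≤ ε) {y : C(StoneSpace 𝒜, ℝ)} {B : ℝ}
    (hB : 0 ≤ B) (hy : ‖y‖ ≤ B) (hly : l.integral (y * y) < η * t ^ 2) :
    |h y| ≤ B * ε + 2 * t * (ofDual h).totalVar ⊤ := by
  obtain ⟨a, ha, ha'⟩ := exists_separating |y| ht
  have h1 : t ^ 2 * l a ≤ l.integral (y * y) := by
    rw [← integral_charFun, ← smul_eq_mul, ← map_smul]
    refine integral_mono _ hl fun x => ?_
    rw [ContinuousMap.smul_apply, ContinuousMap.mul_apply, smul_eq_mul]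
    by_cases hx : a ∈ x.carrier
    · have := ha' x hx
      rw [ContinuousMap.abs_apply] at this
      rw [charFun_of_mem hx, mul_one, ← sq, ← sq_abs (y x)]
      exact pow_le_pow_left₀ ht.le this 2
    · rw [charFun_of_notMem hx, mul_zero]
      exact mul_self_nonneg _
  have h2 : l a < η := by
    have : 0 < t ^ 2 := by positivity
    nlinarith
  have h3 : (ofDual h).totalVar.integral |y|
      ≤ (ofDual h).totalVar.integral (B • charFun a + (2 * t) • charFun ⊤) := by
    refine integral_mono _ (totalVar_nonneg _) fun x => ?_
    rw [ContinuousMap.add_apply, ContinuousMap.smul_apply, ContinuousMap.smul_apply, smul_eq_mul,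
      smul_eq_mul, charFun_of_mem x.top_mem]
    by_cases hx : a ∈ x.carrier
    · rw [charFun_of_mem hx, ContinuousMap.abs_apply]
      have := (y.norm_coe_le_norm x).trans hy
      rw [Real.norm_eq_abs] at this
      linarith
    · rw [charFun_of_notMem hx]
      linarith [ha x hx]
  rw [map_add, map_smul, map_smul, integral_charFun, integral_charFun, smul_eq_mul,
    smul_eq_mul] at h3
  have h4 := mul_le_mul_of_nonneg_left (hc a h2) hB
  linarith [abs_apply_le_integral_totalVar h y]

/-- A bounded, pointwise null sequence of functionals with uniformly exhaustive variations cannot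
exceed `δ`, on each of its initial segments, at a suitable point of the unit ball. -/
lemma exists_forall_norm_le_one_exists_apply_lt {h : ℕ → StrongDual ℝ C(StoneSpace 𝒜, ℝ)} {M : ℝ}
    (hM : ∀ n, ‖h n‖ ≤ M) (hlim : ∀ y, Tendsto (fun n => h n y) atTop (𝓝 0))
    (hex : UniformlyExhaustive fun n => (ofDual (h n)).totalVar) {δ : ℝ} (hδ : 0 < δ) :
    ∃ m, ∀ y, ‖y‖ ≤ 1 → ∃ i ≤ m, h i y < δ := by
  by_contra! hcon
  have hM0 : 0 ≤ M := (norm_nonneg (h 0)).trans (hM 0)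
  have htop (n : ℕ) : (ofDual (h n)).totalVar ⊤ ≤ 3 * M := by
    refine totalVar_le _ (fun a => ?_) ⊤
    have := sum_abs_ofDual_le (h n) {a} id (by simp)
    rw [Finset.sum_singleton] at this
    exact this.trans (hM n)
  obtain ⟨N, η, hη, hN⟩ := hex.exists_control (fun n a => totalVar_nonneg _ a)
    (show 0 < δ / 8 by positivity)
  set l : FinAddSignedMeasure 𝒜 :=
    finsetSum (Finset.range N) fun n => (ofDual (h n)).totalVar with hl_def
  have hl (a : 𝒜) : 0 ≤ l a := by
    rw [hl_def, finsetSum_apply]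
    exact Finset.sum_nonneg fun _ _ => totalVar_nonneg _ a
  have hcontrol (n : ℕ) (a : 𝒜) (ha : l a < η) : (ofDual (h n)).totalVar a ≤ δ / 8 := by
    refine hN a (fun j hj => lt_of_le_of_lt ?_ ha) n
    exact Finset.single_le_sum (f := fun j => (ofDual (h j)).totalVar a)
      (fun j _ => totalVar_nonneg _ a) (Finset.mem_range.2 hj)
  -- With `B = 2`, `ε = δ / 8` and this `t`, Chebyshev's inequality gives the bound `δ / 2`.
  set t : ℝ := δ / (24 * (M + 1)) with ht_def
  have ht : 0 < t := by positivity
  have htM : 2 * t * (3 * M) ≤ δ / 4 := by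
    rw [ht_def, div_eq_mul_inv]
    have : (24 * (M + 1))⁻¹ * (24 * (M + 1)) = 1 := inv_mul_cancel₀ (by positivity)
    have h1 : 0 < (24 * (M + 1))⁻¹ := by positivity
    nlinarith [mul_pos hδ h1]
  let q : C(StoneSpace 𝒜, ℝ) → ℝ := fun y => l.integral (y * y)
  let C : ℕ → Set C(StoneSpace 𝒜, ℝ) := fun m => {y | ‖y‖ ≤ 1 ∧ ∀ i ≤ m, δ ≤ h i y}
  obtain ⟨m, y, hy, hyk⟩ := exists_forall_exists_sub_lt_of_parallelogram (q := q) (C := C)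
    (B := ‖l.integral‖) (κ := η * t ^ 2 / 8)
    (fun y => by
      have := l.integral_mono hl (y := 0) (z := y * y) fun x => mul_self_nonneg (y x)
      rwa [map_zero] at this)
    (fun y z => by
      have h1 : (y - z) * (y - z) = (2 : ℝ) • (y * y) + (2 : ℝ) • (z * z)
          - (4 : ℝ) • (((1 / 2 : ℝ) • (y + z)) * ((1 / 2 : ℝ) • (y + z))) := by
        ext x
        simp only [ContinuousMap.sub_apply, ContinuousMap.mul_apply, ContinuousMap.add_apply,
          ContinuousMap.smul_apply, smul_eq_mul]
        ring
      simp only [q, h1, map_sub, map_add, map_smul, smul_eq_mul])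
    (fun i j hij y hy => ⟨hy.1, fun k hk => hy.2 k (hk.trans hij)⟩)
    (fun m => hcon m)
    (fun m y hy z hz => by
      refine ⟨?_, fun i hi => ?_⟩
      · rw [norm_smul, Real.norm_of_nonneg (by norm_num)]
        linarith [norm_add_le y z, hy.1, hz.1]
      · rw [map_smul, map_add, smul_eq_mul]
        linarith [hy.2 i hi, hz.2 i hi])
    (fun y hy => by
      refine (le_abs_self _).trans ((l.integral.le_opNorm _).trans
        (mul_le_of_le_one_right (norm_nonneg _) ((norm_mul_le y y).trans ?_)))
      exact mul_le_one₀ hy.1 (norm_nonneg _) hy.1)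
    (by positivity)
  have hlow (k : ℕ) (hk : m ≤ k) : δ / 2 ≤ h k y := by
    obtain ⟨z, hz, hyz⟩ := hyk k hk
    have h1 := abs_apply_le_of_integral_mul_self_lt hl (h k) ht (hcontrol k) (y := y - z)
      zero_le_two (by linarith [norm_sub_le y z, hy.1, hz.1])
      (by linarith [show q (y - z) = l.integral ((y - z) * (y - z)) from rfl])
    have h2 := mul_le_mul_of_nonneg_left (htop k) (by positivity : 0 ≤ 2 * t)
    rw [map_sub] at h1
    linarith [(abs_le.1 h1).1, hz.2 k le_rfl]
  have := ge_of_tendsto (hlim y) ((eventually_ge_atTop m).mono hlow)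
  linarith

lemma tendsto_bidual_apply_of_uniformlyExhaustive {h : ℕ → StrongDual ℝ C(StoneSpace 𝒜, ℝ)}
    {M : ℝ} (hM : ∀ n, ‖h n‖ ≤ M) (hlim : ∀ y, Tendsto (fun n => h n y) atTop (𝓝 0))
    (hex : UniformlyExhaustive fun n => (ofDual (h n)).totalVar)
    (F : StrongDual ℝ (StrongDual ℝ C(StoneSpace 𝒜, ℝ))) :
    Tendsto (fun n => F (h n)) atTop (𝓝 0) :=
  tendsto_bidual_apply_of_forall_subsequence (fun φ hφ _ hδ =>
    exists_forall_norm_le_one_exists_apply_lt (h := fun n => h (φ n)) (fun _ => hM _)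
      (fun y => (hlim y).comp hφ.tendsto_atTop)
      (fun C hC ε hε => (hex C hC ε hε).imp fun _ hk n => hk (φ n)) hδ) F

/-- A pointwise null sequence of functionals has uniformly exhaustive variations, provided that
sequences of measures which are large on a disjoint sequence cannot converge pointwise. -/
lemma uniformlyExhaustive_of_forall_not_tendsto
    (hcond : ∀ (A : ℕ → 𝒜) (ε : ℝ) (μ : ℕ → FinAddSignedMeasure 𝒜),
      (∀ m n : ℕ, m ≠ n → A m ⊓ A n = ⊥) → 0 < ε → (∃ C : ℝ≥0, ∀ n, (μ n).variation ≤ C) →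
      (∀ n, ε < |μ n (A n)|) → ∃ a : 𝒜, ¬ ∃ l : ℝ, Tendsto (fun n => μ n a) atTop (𝓝 l))
    {h : ℕ → StrongDual ℝ C(StoneSpace 𝒜, ℝ)} {M : ℝ} (hM : ∀ n, ‖h n‖ ≤ M)
    (hlim : ∀ y, Tendsto (fun n => h n y) atTop (𝓝 0)) :
    UniformlyExhaustive fun n => (ofDual (h n)).totalVar := by
  classical
  intro C hC ε hε
  by_contra! hcon
  choose n hn using hcon
  have hε4 : 0 < ε / 4 := by positivity
  choose B hBC hB using fun k => (ofDual (h (n k))).exists_lt_of_lt_totalVar (a := C k)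
    (ε := ε / 4) (by linarith [hn k])
  have hdisj : Pairwise fun i j => Disjoint (B i) (B j) := fun i j hij =>
    (hC hij).mono (hBC i) (hBC j)
  -- Each functional is large on finitely many `B k` only, because its variation is finite.
  have hfin (j : ℕ) : (n ⁻¹' {j}).Finite := by
    by_contra hinf
    obtain ⟨r, hr⟩ := exists_nat_gt (‖h j‖ / (ε / 4))
    obtain ⟨t, ht, rfl⟩ := (show (n ⁻¹' {j}).Infinite from hinf).exists_subset_card_eq r
    rw [div_lt_iff₀ hε4] at hr
    have h1 := sum_abs_ofDual_le (h j) t B fun i _ k _ hik => hdisj hik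
    have h2 : t.card • (ε / 4) ≤ ∑ k ∈ t, |h j (charFun (B k))| := by
      refine Finset.card_nsmul_le_sum _ _ _ fun k hk => ?_
      have h3 : n k = j := ht hk
      rw [← h3]
      exact (hB k).le
    rw [nsmul_eq_mul] at h2
    linarith
  have hn_lim : Tendsto n atTop atTop := by
    rw [← Nat.cofinite_eq_atTop]
    exact Tendsto.cofinite_of_finite_preimage_singleton hfin
  obtain ⟨a, ha⟩ := hcond B (ε / 4) (fun k => ofDual (h (n k)))
    (fun i j hij => (hdisj hij).eq_bot) hε4
    ⟨⟨M, (norm_nonneg (h 0)).trans (hM 0)⟩, fun k => (variation_ofDual_le _).trans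
      (ENNReal.coe_le_coe.2 (hM (n k)))⟩ hB
  exact ha ⟨0, (hlim (charFun a)).comp hn_lim⟩

end FinAddSignedMeasure

/-! ### The characterization of the Grothendieck property -/

lemma tendsto_toWeakDual_iff {X : Type*} [NormedAddCommGroup X] [NormedSpace ℝ X]
    {f : ℕ → StrongDual ℝ X} {g : StrongDual ℝ X} :
    Tendsto (fun n => StrongDual.toWeakDual (f n)) atTop (𝓝 (StrongDual.toWeakDual g)) ↔
      ∀ y, Tendsto (fun n => f n y) atTop (𝓝 (g y)) :=
  tendsto_iff_forall_eval_tendsto_topDualPairing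

lemma tendsto_toWeakSpace_iff {E : Type*} [NormedAddCommGroup E] [NormedSpace ℝ E]
    {f : ℕ → E} {g : E} :
    Tendsto (fun n => toWeakSpace ℝ E (f n)) atTop (𝓝 (toWeakSpace ℝ E g)) ↔
      ∀ F : StrongDual ℝ E, Tendsto (fun n => F (f n)) atTop (𝓝 (F g)) := by
  refine WeakBilin.tendsto_iff_forall_eval_tendsto (topDualPairing ℝ E).flip fun x y hxy => ?_
  exact (SeparatingDual.eq_iff_forall_dual_eq (R := ℝ)).2 fun F => LinearMap.congr_fun hxy F

theorem hasGrothendieckProperty_iff_forall {X : Type*} [NormedAddCommGroup X] [NormedSpace ℝ X]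
    [CompleteSpace X] : HasGrothendieckProperty X ↔
      ∀ (f : ℕ → StrongDual ℝ X) (g : StrongDual ℝ X),
        (∀ y, Tendsto (fun n => f n y) atTop (𝓝 (g y))) →
        ∀ F : StrongDual ℝ (StrongDual ℝ X), Tendsto (fun n => F (f n)) atTop (𝓝 (F g)) := by
  simp only [HasGrothendieckProperty, tendsto_toWeakDual_iff, tendsto_toWeakSpace_iff]
  exact forall₂_congr fun f g => ⟨fun h => h.1, fun h => ⟨h, fun hF y =>
    hF (ContinuousLinearMap.apply ℝ ℝ y)⟩⟩

/-- The pointwise limit of a bounded sequence of finitely additive measures. -/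
def FinAddSignedMeasure.ofTendsto {𝒜 : Type*} [BooleanAlgebra 𝒜]
    (μ : ℕ → FinAddSignedMeasure 𝒜) {C : ℝ} (hC : ∀ n a, |μ n a| ≤ C) (l : 𝒜 → ℝ)
    (hl : ∀ a, Tendsto (fun n => μ n a) atTop (𝓝 (l a))) : FinAddSignedMeasure 𝒜 where
  toFun := l
  map_sup_of_disjoint a b h := tendsto_nhds_unique (hl (a ⊔ b))
    (((hl a).add (hl b)).congr fun n => ((μ n).map_sup_of_disjoint a b h).symm)
  bounded := ⟨C, fun a => le_of_tendsto' (hl a).abs fun n => hC n a⟩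

theorem lemma2p2 {𝒜 : Type*} [BooleanAlgebra 𝒜] :
    HasGrothendieckProperty C(StoneSpace 𝒜, ℝ) ↔
      ∀ (A : ℕ → 𝒜) (ε : ℝ) (μ : ℕ → FinAddSignedMeasure 𝒜),
        (∀ m n : ℕ, m ≠ n → A m ⊓ A n = ⊥) →
        0 < ε →
        (∃ C : ℝ≥0, ∀ n, (μ n).variation ≤ C) →
        (∀ n, ε < |μ n (A n)|) →
        ∃ a : 𝒜, ¬ ∃ l : ℝ, Tendsto (fun n => μ n a) atTop (𝓝 l) := by
  rw [hasGrothendieckProperty_iff_forall]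
  constructor
  · rintro hG A ε μ hA hε ⟨C, hC⟩ hbig
    by_contra! hconv
    choose l hl using hconv
    have hC' (n : ℕ) (a : 𝒜) : |μ n a| ≤ C := (μ n).abs_le_of_variation_le (hC n) a
    let ν := FinAddSignedMeasure.ofTendsto μ hC' l hl
    have hweak := hG (fun n => (μ n).integral) ν.integral
      (FinAddSignedMeasure.tendsto_integral (ν := ν) (K := 3 * C)
        (fun n => (μ n).norm_integral_le.trans ((μ n).totalVar_le (hC' n) ⊤)) hl)
    have h0 := (FinAddSignedMeasure.tendsto_diagonal_of_weak
      (fun m n hmn => disjoint_iff.2 (hA m n hmn)) hweak).abs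
    simp only [FinAddSignedMeasure.integral_charFun, abs_zero] at h0
    exact absurd (ge_of_tendsto' h0 fun n => (hbig n).le) (not_le.2 hε)
  · intro hcond f g hfg F
    obtain ⟨M, hM⟩ := banach_steinhaus (g := fun n => f n - g) fun y => by
      obtain ⟨B, hB⟩ := ((hfg y).sub_const (g y)).norm.bddAbove_range
      exact ⟨B, fun n => hB ⟨n, rfl⟩⟩
    have hlim (y : C(StoneSpace 𝒜, ℝ)) : Tendsto (fun n => (f n - g) y) atTop (𝓝 0) := by
      have := (hfg y).sub_const (g y)
      rwa [sub_self] at this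
    have h0 := FinAddSignedMeasure.tendsto_bidual_apply_of_uniformlyExhaustive hM hlim
      (FinAddSignedMeasure.uniformlyExhaustive_of_forall_not_tendsto hcond hM hlim) F
    have h1 := h0.add_const (F g)
    rw [zero_add] at h1
    refine h1.congr fun n => ?_
    rw [map_sub, sub_add_cancel]
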